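/- Let $n,k,d$ be integers with $1\le k\le n-1$ and $1\le d\le n-1$, and let $\alpha,\beta\in[0,\infty]$ (with $0\cdot\infty=0$). **The scheme.** Consider a network of $n$ storage nodes, sorted in an arbitrary order and denoted accordingly by $1,\dots,n$. Put $c=\lfloor n/(n-d)\rfloor$. The first $n-d$ nodes form the first *complete family*, the next $n-d$ nodes the second, and so on, up to the $c$-th; the remaining $n \bmod (n-d)$ nodes (if any) form the *incomplete family*. In the *family helper selection (FHS) scheme* $F$, a node $i$ of a complete family has as its helper set $D_i$ all nodes outside its own family, and a node $i$ of the incomplete family has $D_i=\{1,\dots,d\}$. **Information flow graphs.** For a finite sequence of single node failures (a node may fail several times; the sequence may be empty), the *information flow graph* (IFG) is the following directed graph with edge capacities. It has a source $s$. Each storage node is a pair of vertices $x_{\mathrm{in}},x_{\mathrm{out}}$ joined by an edge $x_{\mathrm{in}}\to x_{\mathrm{out}}$ of capacity $\alpha$. There are $n$ initial storage nodes, and $s$ is joined to the input vertex of each of them by an edge of infinite capacity. Whenever a node $i$ fails, its current storage node becomes inactive and is replaced by a new storage node (the newcomer), whose input vertex receives an edge of capacity $\beta$ from the output vertex of the currently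 active storage node of each helper $u\in D_i$. Finally, for each choice of $k$ of the $n$ storage nodes that are active at the end, there is a *data collector* $t$, which receives an edge of infinite capacity from the output vertex of each of these $k$ nodes. Let $\mathcal G_F$ be the collection of the IFGs for all finite failure sequences, $\mathrm{DC}(G)$ the set of the $\binom nk$ data collectors of $G$, and $\mathrm{mincut}_G(s,t)$ the minimum, over all vertex sets $U$ with $s\in U$, $t\notin U$, of the total capacity of the edges from $U$ to its complement. **Family index permutations.** The *family index vector* is the $n$-dimensional vector $$\bigl(\underbrace{1,\dots,1}_{n-d},\underbrace{2,\dots,2}_{n-d},\dots,\underbrace{c-1,\dots,c-1}_{n-d},\underbrace{c,\dots,c}_{n\bmod(n-d)},\underbrace{-c,\dots,-c}_{n-d-(n\bmod(n-d))},\underbrace{0,\dots,0}_{n\bmod(n-d)}\bigr).$$ A *family index permutation* $\pi_f$ is any rearrangement of this vector. For $1\le i\le n$ define $y_i(\pi_f)$ as follows. If the $i$-th coordinate of $\pi_f$ is $0$, then $y_i(\pi_f)$ is the number of $j<i$ for which the $j$-th coordinate is $>0$. Otherwise, $y_i(\pi_f)$ is the number of $j<i$ for which the absolute values of the $j$-th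 and the $i$-th coordinates differ. (One always has $y_i(\pi_f)\le d$.) **Proposition.** Both minima below are attained, and $$\min_{G\in\mathcal G_F}\ \min_{t\in \mathrm{DC}(G)}\ \mathrm{mincut}_G(s,t)\;=\;\min_{\pi_f}\ \sum_{i=1}^{k}\min\bigl((d-y_i(\pi_f))\,\beta,\ \alpha\bigr),$$ where $\pi_f$ ranges over all family index permutations. -/

import Mathlib

open scoped ENNReal

/-! ### Minimum cuts -/

/-- The minimum cut value separating `s` from `t` in a finite directed graph with edge capacities
`cap` (capacity `0` for a non-edge): the minimum, over all vertex sets `U` with `s ∈ U`, `t ∉ U`,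
of the total capacity of the edges that go from `U` to its complement. -/
noncomputable def minCut {V : Type*} [Fintype V] [DecidableEq V] (cap : V → V → ℝ≥0∞)
    (s t : V) : ℝ≥0∞ :=
  ⨅ U : {U : Finset V // s ∈ U ∧ t ∉ U}, ∑ u ∈ U.1, ∑ v ∈ (U.1)ᶜ, cap u v

/-! ### Information flow graphs

The storage network has `n` nodes, `Fin n`. A failure history of length `T` is a sequence
`F : Fin T → Fin n`; `F τ` is the node that fails, and is repaired, at time `τ`. -/

/-- The storage nodes of an information flow graph: `Sum.inl i` is the initial node `i`,
`Sum.inr τ` is the newcomer that replaces node `F τ` at time `τ`. -/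
abbrev StorageNode (n T : ℕ) : Type := Fin n ⊕ Fin T

/-- A choice of `k` out of the `n` (active) nodes. -/
abbrev KSubset (n k : ℕ) : Type := {S : Finset (Fin n) // S.card = k}

/-- The vertices of an information flow graph: the source, the input and the output vertex of each
storage node, and the data collectors, one for each choice of `k` of the `n` active nodes. -/
inductive IFGVertex (n k T : ℕ) : Type
  | source : IFGVertex n k T
  | inp (x : StorageNode n T) : IFGVertex n k T
  | out (x : StorageNode n T) : IFGVertex n k T
  | dc (S : KSubset n k) : IFGVertex n k T
  deriving DecidableEq, Fintype

/-- The index in the network of a storage node of the information flow graph. -/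
def nodeIndex {n T : ℕ} (F : Fin T → Fin n) : StorageNode n T → Fin n
  | Sum.inl i => i
  | Sum.inr τ => F τ

/-- `IsActive F t x`: the storage node `x` is present and has not failed after the failures at the
times `τ < t` (and the corresponding repairs). -/
def IsActive {n T : ℕ} (F : Fin T → Fin n) (t : ℕ) : StorageNode n T → Prop
  | Sum.inl i => ∀ τ : Fin T, τ.val < t → F τ ≠ i
  | Sum.inr σ => σ.val < t ∧ ∀ τ : Fin T, σ < τ → τ.val < t → F τ ≠ F σ

open Classical in
/-- The edge capacities of the information flow graph that a stationary helper selection scheme,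
with helper sets `D i`, produces under the failure history `F`: capacity `∞` from the source to
the input of each initial node, capacity `α` from input to output of each storage node, capacity
`β` from the output of each helper (active at the time of the repair) to the input of the newcomer,
capacity `∞` from the chosen `k` finally active nodes to the data collector, and no other edge. -/
noncomputable def ifgCapacity {n : ℕ} (k : ℕ) (D : Fin n → Finset (Fin n)) (α β : ℝ≥0∞) {T : ℕ}
    (F : Fin T → Fin n) : IFGVertex n k T → IFGVertex n k T → ℝ≥0∞
  | .source, .inp (Sum.inl _) => ∞
  | .inp x, .out y => if x = y then α else 0
  | .out x, .inp (Sum.inr τ) =>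
      if IsActive F τ.val x ∧ nodeIndex F x ∈ D (F τ) then β else 0
  | .out x, .dc S => if IsActive F T x ∧ nodeIndex F x ∈ S.1 then ∞ else 0
  | _, _ => 0

/-- The set of all values `mincut_G(s, t)`, where `G` ranges over all the information flow graphs
of the scheme with helper sets `D` (over all finite failure histories) and `t` ranges over the data
collectors of `G`. -/
def minCutValues {n : ℕ} (k : ℕ) (D : Fin n → Finset (Fin n)) (α β : ℝ≥0∞) : Set ℝ≥0∞ :=
  {v | ∃ (T : ℕ) (F : Fin T → Fin n) (t : KSubset n k),
    v = minCut (ifgCapacity k D α β F) IFGVertex.source (IFGVertex.dc t)}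

/-! ### The family helper selection scheme

Positions in the sorted list of nodes are counted from `0`, so that position `m` is the node called
`m + 1` when nodes are numbered from `1` to `n`. -/

/-- The number `c = ⌊n / (n - d)⌋` of complete families. -/
def numFamilies (n d : ℕ) : ℕ := n / (n - d)

/-- The helper sets of the family helper selection scheme, where `e i` is the position of node `i`
in the chosen ordering of the nodes. Consecutive blocks of `n - d` positions are the families (the
last, shorter one, if any, is the incomplete family). A node of a complete family is helped by all
the nodes outside its family; a node of the incomplete family by the first `d` nodes. -/
def fhsHelpers (n d : ℕ) (e : Equiv.Perm (Fin n)) (i : Fin n) : Finset (Fin n) :=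
  if (e i).val < numFamilies n d * (n - d) then
    Finset.univ.filter fun u => (e u).val / (n - d) ≠ (e i).val / (n - d)
  else
    Finset.univ.filter fun u => (e u).val < d

/-- The family index vector
`(1, …, 1, 2, …, 2, …, c, …, c, -c, …, -c, 0, …, 0)`: each of `1, …, c - 1` occurs `n - d` times,
`c` occurs `n mod (n - d)` times, `-c` occurs `n - d - (n mod (n - d))` times, and `0` occurs
`n mod (n - d)` times. -/
def familyIndexVector (n d : ℕ) (m : Fin n) : ℤ :=
  if m.val < (numFamilies n d - 1) * (n - d) + n % (n - d) then ((m.val / (n - d) + 1 : ℕ) : ℤ)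
  else if m.val < numFamilies n d * (n - d) then -(numFamilies n d : ℤ)
  else 0

/-- A family index permutation is a rearrangement of the family index vector. -/
def IsFamilyIndexPermutation (n d : ℕ) (π : Fin n → ℤ) : Prop :=
  ∃ σ : Equiv.Perm (Fin n), π = familyIndexVector n d ∘ σ

/-- The function `y_i(π)`. -/
def yValue {n : ℕ} (π : Fin n → ℤ) (i : Fin n) : ℕ :=
  if π i = 0 then (Finset.univ.filter fun j : Fin n => j < i ∧ 0 < π j).card
  else (Finset.univ.filter fun j : Fin n => j < i ∧ |π j| ≠ |π i|).card

/-- The sum `∑_{i=1}^k min ((d - y_i(π)) β, α)`. For a family index permutation `π` one always has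
`y_i(π) ≤ d` (exactly `d` entries are positive when `0` occurs, and each absolute value `1, …, c`
occurs `n - d` times), so the subtraction of natural numbers is the true one. -/
noncomputable def familySum {n : ℕ} (k d : ℕ) (α β : ℝ≥0∞) (π : Fin n → ℤ) : ℝ≥0∞ :=
  ∑ i ∈ Finset.univ.filter (fun i : Fin n => i.val < k),
    min (((d - yValue π i : ℕ) : ℝ≥0∞) * β) α

/-! ### Cuts as sums over the vertices on the sink side -/

/-! Both minima equal the minimum, over all orders `ρ` of the nodes, of the sum of the first `k`
values of `orderTerm`. The min-cut side needs only that every helper set has `d` elements. Given a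
cut `U`, sort the nodes by the time their output first leaves `U`. For a finite cut, the first `k`
of them do leave. Each then owns a vertex outside `U` whose inflow is at least its term: either its
edge of capacity `α` is cut, or its newcomer's input is outside `U` while every helper not earlier
in the order still has its output in `U` (`exists_orderTerm_le_inflow`, `exists_sum_orderTerm_le`).
Conversely, letting the first `k` nodes of `ρ` fail in that order yields a cut at most the sum
(`exists_minCut_le_sum_orderTerm`). For the family scheme, the family index vector encodes the
helper relation (`mem_fhsHelpers_iff`), so reading it along `ρ` turns `earlierHelpers` into
`yValue`, and every family index permutation arises this way. -/

lemma minCut_le_sum {V : Type*} [Fintype V] [DecidableEq V] (cap : V → V → ℝ≥0∞) {s t : V}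
    (U : Finset V) (hs : s ∈ U) (ht : t ∉ U) :
    minCut cap s t ≤ ∑ v ∈ Uᶜ, ∑ u ∈ U, cap u v := by
  rw [Finset.sum_comm]
  exact iInf_le (fun U : {U : Finset V // s ∈ U ∧ t ∉ U} =>
    ∑ u ∈ U.1, ∑ v ∈ (U.1)ᶜ, cap u v) ⟨U, hs, ht⟩

lemma le_minCut {V : Type*} [Fintype V] [DecidableEq V] (cap : V → V → ℝ≥0∞) {s t : V}
    {b : ℝ≥0∞} (h : ∀ U : Finset V, s ∈ U → t ∉ U → b ≤ ∑ v ∈ Uᶜ, ∑ u ∈ U, cap u v) :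
    b ≤ minCut cap s t := by
  refine le_iInf fun U => ?_
  rw [Finset.sum_comm]
  exact h U.1 U.2.1 U.2.2

/-! ### Storage nodes -/

/-- The time from which a storage node is present. -/
def birth {n T : ℕ} : StorageNode n T → ℕ
  | Sum.inl _ => 0
  | Sum.inr τ => τ.val + 1

lemma exists_isActive {n T : ℕ} (F : Fin T → Fin n) (t : ℕ) (i : Fin n) :
    ∃ x, IsActive F t x ∧ nodeIndex F x = i ∧ birth x ≤ t := by
  by_cases h : (Finset.univ.filter fun τ : Fin T => τ.val < t ∧ F τ = i).Nonempty
  · obtain ⟨σ, hσ, hmax⟩ := Finset.exists_max_image _ id h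
    simp only [Finset.mem_filter, Finset.mem_univ, true_and, id] at hσ hmax
    refine ⟨Sum.inr σ, ⟨hσ.1, fun τ hτ ht hF => ?_⟩, hσ.2, hσ.1⟩
    exact absurd (hmax τ ⟨ht, hF.trans hσ.2⟩) (not_le.2 hτ)
  · refine ⟨Sum.inl i, fun τ ht hF => h ⟨τ, ?_⟩, rfl, Nat.zero_le _⟩
    simp [ht, hF]

/-! ### Repair orders of an arbitrary stationary scheme -/

/-- The number of helpers of the `p`-th node in the order `ρ` that precede it in this order. -/
def earlierHelpers {n : ℕ} (D : Fin n → Finset (Fin n)) (ρ : Equiv.Perm (Fin n)) (p : Fin n) : ℕ :=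
  (Finset.univ.filter fun q : Fin n => q < p ∧ ρ q ∈ D (ρ p)).card

/-- The contribution of the `p`-th node in the order `ρ` to the minimum cut. -/
noncomputable def orderTerm {n : ℕ} (d : ℕ) (D : Fin n → Finset (Fin n)) (α β : ℝ≥0∞)
    (ρ : Equiv.Perm (Fin n)) (p : Fin n) : ℝ≥0∞ :=
  min (((d - earlierHelpers D ρ p : ℕ) : ℝ≥0∞) * β) α

lemma card_helpers_sdiff {n d : ℕ} {D : Fin n → Finset (Fin n)} (hD : ∀ i, (D i).card = d)
    (ρ : Equiv.Perm (Fin n)) (p : Fin n) :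
    ((D (ρ p)).filter fun i => ∀ q < p, ρ q ≠ i).card = d - earlierHelpers D ρ p := by
  have h1 : ((D (ρ p)).filter fun i => ¬ ∀ q < p, ρ q ≠ i).card = earlierHelpers D ρ p := by
    rw [earlierHelpers, ← Finset.card_map (s := Finset.univ.filter _) ρ.toEmbedding]
    congr 1
    ext i
    simp only [Finset.mem_filter, Finset.mem_map, Finset.mem_univ, true_and,
      Equiv.coe_toEmbedding]
    push Not
    constructor
    · rintro ⟨hi, q, hq, rfl⟩
      exact ⟨q, ⟨hq, hi⟩, rfl⟩
    · rintro ⟨q, ⟨hq, hi⟩, rfl⟩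
      exact ⟨hi, q, hq, rfl⟩
  have h2 := Finset.card_filter_add_card_filter_not (s := D (ρ p)) (fun i => ∀ q < p, ρ q ≠ i)
  rw [hD] at h2
  omega

/-- The sum of the capacities of the edges into `v` that start in `U`. -/
noncomputable def inflow {n k T : ℕ} (D : Fin n → Finset (Fin n)) (α β : ℝ≥0∞)
    (F : Fin T → Fin n) (U : Finset (IFGVertex n k T)) (v : IFGVertex n k T) : ℝ≥0∞ :=
  ∑ u ∈ U, ifgCapacity k D α β F u v

/-! ### Every cut dominates the sum of some repair order. -/

section LowerBound

variable {n k T : ℕ} {D : Fin n → Finset (Fin n)} {α β : ℝ≥0∞} {F : Fin T → Fin n}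
  {U : Finset (IFGVertex n k T)}

lemma capacity_le_inflow {u : IFGVertex n k T} (hu : u ∈ U) (v : IFGVertex n k T) :
    ifgCapacity k D α β F u v ≤ inflow D α β F U v :=
  Finset.single_le_sum (f := fun u => ifgCapacity k D α β F u v) (fun _ _ => zero_le) hu

lemma inflow_out (x : StorageNode n T) (hx : IFGVertex.inp x ∈ U) :
    α ≤ inflow D α β F U (.out x) := by
  refine le_trans ?_ (capacity_le_inflow hx _)
  simp [ifgCapacity]

lemma inflow_inp_inl (i : Fin n) (hs : IFGVertex.source ∈ U) :
    inflow D α β F U (.inp (.inl i)) = ∞ :=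
  top_le_iff.1 (capacity_le_inflow hs _)

lemma inflow_dc {S : KSubset n k} {x : StorageNode n T} (hx : IFGVertex.out x ∈ U)
    (ha : IsActive F T x) (hS : nodeIndex F x ∈ S.1) : inflow D α β F U (.dc S) = ∞ := by
  refine top_le_iff.1 (le_trans ?_ (capacity_le_inflow hx _))
  simp [ifgCapacity, ha, hS]

lemma inflow_inp_inr (τ : Fin T) (A : Finset (Fin n)) (hA : A ⊆ D (F τ))
    (hU : ∀ i ∈ A, ∀ x, IsActive F τ x → nodeIndex F x = i → IFGVertex.out x ∈ U) :
    (A.card : ℝ≥0∞) * β ≤ inflow D α β F U (.inp (.inr τ)) := by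
  choose a ha hai _ using exists_isActive F τ.val
  have hinj : Function.Injective fun i => (IFGVertex.out (a i) : IFGVertex n k T) := by
    intro i j hij
    simp only [IFGVertex.out.injEq] at hij
    rw [← hai i, ← hai j, hij]
  calc (A.card : ℝ≥0∞) * β
      = ∑ i ∈ A, ifgCapacity k D α β F (.out (a i)) (.inp (.inr τ)) := by
        rw [← nsmul_eq_mul, ← Finset.sum_const]
        refine Finset.sum_congr rfl fun i hi => ?_
        simp [ifgCapacity, ha, hai, hA hi]
    _ = ∑ u ∈ A.map ⟨_, hinj⟩, ifgCapacity k D α β F u (.inp (.inr τ)) := by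
        rw [Finset.sum_map]; rfl
    _ ≤ inflow D α β F U (.inp (.inr τ)) := by
        refine Finset.sum_le_sum_of_subset fun u hu => ?_
        obtain ⟨i, hi, rfl⟩ := Finset.mem_map.1 hu
        exact hU i hi _ (ha i) (hai i)

/-- The index in the network of the storage node to which a vertex belongs. -/
def vertexIndex (F : Fin T → Fin n) : IFGVertex n k T → Option (Fin n)
  | .inp x => some (nodeIndex F x)
  | .out x => some (nodeIndex F x)
  | _ => none

open Classical in
/-- The first time at which the output of a storage node of index `i` lies outside `U`, or `T + 1`
if there is no such storage node. -/
noncomputable def exitTime (F : Fin T → Fin n) (U : Finset (IFGVertex n k T)) (i : Fin n) : ℕ :=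
  if h : ∃ t, ∃ x, nodeIndex F x = i ∧ IFGVertex.out x ∉ U ∧ birth x = t then Nat.find h
  else T + 1

lemma exitTime_le {x : StorageNode n T} (hx : IFGVertex.out x ∉ U) :
    exitTime F U (nodeIndex F x) ≤ birth x := by
  classical
  have h : ∃ t, ∃ y, nodeIndex F y = nodeIndex F x ∧ IFGVertex.out y ∉ U ∧ birth y = t :=
    ⟨_, x, rfl, hx, rfl⟩
  rw [exitTime, dif_pos h]
  exact Nat.find_min' h ⟨x, rfl, hx, rfl⟩

lemma exists_birth_eq_exitTime {i : Fin n} (hi : exitTime F U i ≤ T) :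
    ∃ x, nodeIndex F x = i ∧ IFGVertex.out x ∉ U ∧ birth x = exitTime F U i := by
  classical
  unfold exitTime at hi ⊢
  split_ifs at hi ⊢ with h
  · exact Nat.find_spec h
  · omega

/-- The vertex is the output or the input of the first storage node of this index whose output
leaves `U`, according to the side on which its input lies. -/
lemma exists_orderTerm_le_inflow {d : ℕ} (hD : ∀ i, (D i).card = d)
    (hs : IFGVertex.source ∈ U) {ρ : Equiv.Perm (Fin n)}
    (hρ : Monotone (exitTime F U ∘ ρ)) {p : Fin n} (hp : exitTime F U (ρ p) ≤ T) :
    ∃ v ∉ U, vertexIndex F v = some (ρ p) ∧ orderTerm d D α β ρ p ≤ inflow D α β F U v := by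
  obtain ⟨x, hxi, hxU, hxb⟩ := exists_birth_eq_exitTime hp
  by_cases hin : IFGVertex.inp x ∈ U
  · exact ⟨.out x, hxU, by rw [← hxi, vertexIndex], (min_le_right _ _).trans (inflow_out x hin)⟩
  refine ⟨.inp x, hin, by rw [← hxi, vertexIndex], ?_⟩
  rcases x with i | τ
  · simp [inflow_inp_inl i hs]
  refine (min_le_left _ _).trans ?_
  rw [← card_helpers_sdiff hD]
  refine inflow_inp_inr τ _ ?_ ?_
  · rw [show F τ = ρ p from hxi]
    exact Finset.filter_subset _ _
  · intro i hi y hy hyi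
    by_contra hyU
    -- A helper active at time `τ` is born no later than `τ`, the newcomer at `τ + 1`. This
    -- strictness makes the order among equal exit times irrelevant.
    have hlt : exitTime F U i < exitTime F U (ρ p) := by
      rw [← hxb, ← hyi]
      refine (exitTime_le hyU).trans_lt ?_
      rcases y with j | σ
      · simp [birth]
      · have := hy.1
        simp only [birth]
        omega
    refine (Finset.mem_filter.1 hi).2 (ρ.symm i) ?_ (by simp)
    by_contra hq
    have := hρ (not_lt.1 hq)
    simp only [Function.comp_apply, Equiv.apply_symm_apply] at this
    omega

lemma exists_sum_orderTerm_le {d : ℕ} (hD : ∀ i, (D i).card = d) (hs : IFGVertex.source ∈ U)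
    {S : KSubset n k} (hS : IFGVertex.dc S ∉ U) :
    ∃ ρ : Equiv.Perm (Fin n), ∑ p ∈ Finset.univ.filter (fun p : Fin n => p.val < k),
      orderTerm d D α β ρ p ≤ ∑ v ∈ Uᶜ, inflow D α β F U v := by
  by_cases hdc : ∃ x, IsActive F T x ∧ nodeIndex F x ∈ S.1 ∧ IFGVertex.out x ∈ U
  · obtain ⟨x, hx, hxS, hxU⟩ := hdc
    -- An edge into the collector makes the cut infinite, so any order will do.
    refine ⟨1, le_trans le_top ?_⟩
    rw [← inflow_dc hxU hx hxS (D := D) (α := α) (β := β)]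
    exact Finset.single_le_sum (f := inflow D α β F U) (fun _ _ => zero_le)
      (Finset.mem_compl.2 hS)
  push Not at hdc
  have hST : ∀ i ∈ S.1, exitTime F U i ≤ T := by
    intro i hi
    obtain ⟨x, hx, rfl, hxb⟩ := exists_isActive F T i
    exact (exitTime_le (hdc x hx hi)).trans hxb
  let ρ := Tuple.sort (exitTime F U)
  have hρ : Monotone (exitTime F U ∘ ρ) := Tuple.monotone_sort _
  have hpT : ∀ p : Fin n, p.val < k → exitTime F U (ρ p) ≤ T := by
    intro p hp
    by_contra hlt
    -- Otherwise all `k` nodes read by the collector, which exit by time `T`, would precede position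
    -- `p < k`.
    have hsub : S.1.map ρ.symm.toEmbedding ⊆ Finset.Iio p := by
      intro q hq
      obtain ⟨i, hi, rfl⟩ := Finset.mem_map.1 hq
      rw [Finset.mem_Iio]
      by_contra hle
      have h1 := hρ (not_lt.1 hle)
      simp only [Function.comp_apply, Equiv.coe_toEmbedding, Equiv.apply_symm_apply] at h1
      exact hlt (h1.trans (hST i hi))
    have := Finset.card_le_card hsub
    rw [Finset.card_map, S.2, Fin.card_Iio] at this
    omega
  have hv : ∀ p : {p : Fin n // p.val < k}, ∃ v ∉ U, vertexIndex F v = some (ρ p) ∧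
      orderTerm d D α β ρ p ≤ inflow D α β F U v :=
    fun p => exists_orderTerm_le_inflow hD hs hρ (hpT p p.2)
  choose v hvU hvi hvle using hv
  -- The chosen vertices belong to different nodes, so their inflows are separate terms of the cut.
  have hinj : Function.Injective v := by
    intro p q hpq
    have h := hvi p
    rw [hpq, hvi q, Option.some.injEq] at h
    exact Subtype.ext (ρ.injective h.symm)
  refine ⟨ρ, ?_⟩
  calc ∑ p ∈ Finset.univ.filter (fun p : Fin n => p.val < k), orderTerm d D α β ρ p
      = ∑ p : {p : Fin n // p.val < k}, orderTerm d D α β ρ p :=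
        Finset.sum_subtype _ (by simp) _
    _ ≤ ∑ p : {p : Fin n // p.val < k}, inflow D α β F U (v p) :=
        Finset.sum_le_sum fun p _ => hvle p
    _ = ∑ w ∈ Finset.univ.map ⟨v, hinj⟩, inflow D α β F U w := by
        rw [Finset.sum_map]; rfl
    _ ≤ ∑ w ∈ Uᶜ, inflow D α β F U w := by
        refine Finset.sum_le_sum_of_subset fun w hw => ?_
        obtain ⟨p, -, rfl⟩ := Finset.mem_map.1 hw
        exact Finset.mem_compl.2 (hvU p)

end LowerBound

/-! ### A cut for each repair order -/

/-- The first `k` nodes of `ρ` fail once each, in order, and the collector reads exactly their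
newcomers. Each newcomer is cut where it is cheaper: before its input or between input and output.
-/
lemma exists_minCut_le_sum_orderTerm {n k d : ℕ} (hkn : k ≤ n) {D : Fin n → Finset (Fin n)}
    (hD : ∀ i, (D i).card = d) (α β : ℝ≥0∞) (ρ : Equiv.Perm (Fin n)) :
    ∃ (F : Fin k → Fin n) (S : KSubset n k),
      minCut (ifgCapacity k D α β F) IFGVertex.source (IFGVertex.dc S) ≤
        ∑ p ∈ Finset.univ.filter (fun p : Fin n => p.val < k), orderTerm d D α β ρ p := by
  classical
  let F : Fin k → Fin n := fun τ => ρ (Fin.castLE hkn τ)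
  have hF : Function.Injective F := ρ.injective.comp (Fin.castLE_injective hkn)
  let S : KSubset n k := ⟨Finset.univ.map ⟨F, hF⟩, by simp⟩
  let c : Fin k → ℝ≥0∞ := fun τ =>
    ((d - earlierHelpers D ρ (Fin.castLE hkn τ) : ℕ) : ℝ≥0∞) * β
  let N : Fin k → Finset (IFGVertex n k k) := fun τ =>
    if c τ ≤ α then {.inp (.inr τ), .out (.inr τ)} else {.out (.inr τ)}
  -- `W` is the sink side of the cut; all initial nodes stay on the source side.
  let W : Finset (IFGVertex n k k) := {.dc S} ∪ Finset.univ.biUnion N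
  have houtN : ∀ τ, IFGVertex.out (.inr τ) ∈ W := by
    intro τ
    refine Finset.mem_union_right _ (Finset.mem_biUnion.2 ⟨τ, Finset.mem_univ _, ?_⟩)
    simp only [N]
    split_ifs <;> simp
  have hinl : ∀ x, IFGVertex.out x ∈ Wᶜ → ∃ i, x = Sum.inl i := by
    rintro (i | τ) hx
    · exact ⟨i, rfl⟩
    · exact absurd (houtN τ) (Finset.mem_compl.1 hx)
  have hsrc : IFGVertex.source ∈ Wᶜ := by
    simp only [W, N, Finset.mem_compl, Finset.mem_union, Finset.mem_biUnion, Finset.mem_univ,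
      true_and]
    rintro (h | ⟨τ, h⟩)
    · simp at h
    · split_ifs at h <;> simp at h
  have hsink : IFGVertex.dc S ∉ Wᶜ := by simp [W]
  have hdc : inflow D α β F Wᶜ (.dc S) = 0 := by
    refine Finset.sum_eq_zero fun u hu => ?_
    rcases u with _ | x | x | S'
    · rfl
    · rfl
    · obtain ⟨i, rfl⟩ := hinl x hu
      refine if_neg ?_
      rintro ⟨ha, hi⟩
      obtain ⟨τ, -, hτ⟩ := Finset.mem_map.1 hi
      exact ha τ τ.2 hτ
    · rfl
  have hinp : ∀ τ, inflow D α β F Wᶜ (.inp (.inr τ)) ≤ c τ := by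
    intro τ
    -- Only initial outputs lie on the source side, and those of nodes that failed earlier are
    -- inactive; the helpers in `A` remain.
    let A := (D (ρ (Fin.castLE hkn τ))).filter fun i => ∀ q < Fin.castLE hkn τ, ρ q ≠ i
    calc inflow D α β F Wᶜ (.inp (.inr τ))
        ≤ ∑ u ∈ A.image fun i => (IFGVertex.out (.inl i) : IFGVertex n k k), β := by
          rw [inflow]
          refine le_trans (Finset.sum_le_sum_of_ne_zero (fun u hu h0 => ?_))
            (Finset.sum_le_sum fun u hu => ?_)
          · rcases u with _ | x | x | S'
            · exact absurd rfl h0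
            · exact absurd rfl h0
            · obtain ⟨i, rfl⟩ := hinl x hu
              have h1 : IsActive F τ.val (Sum.inl i) ∧ i ∈ D (F τ) := by
                by_contra h1
                exact h0 (if_neg h1)
              refine Finset.mem_image_of_mem _ (Finset.mem_filter.2 ⟨h1.2, fun q hq => ?_⟩)
              exact h1.1 ⟨q.val, lt_trans hq τ.2⟩ hq
            · exact absurd rfl h0
          · obtain ⟨i, -, rfl⟩ := Finset.mem_image.1 hu
            simp only [ifgCapacity]
            split_ifs
            · exact le_rfl
            · exact zero_le
      _ ≤ c τ := by
          rw [Finset.sum_const, nsmul_eq_mul]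
          simp only [c]
          rw [← card_helpers_sdiff hD]
          gcongr
          exact Finset.card_image_le
  have hout : ∀ τ, inflow D α β F Wᶜ (.out (.inr τ)) ≤
      if IFGVertex.inp (.inr τ) ∈ Wᶜ then α else 0 := by
    intro τ
    calc inflow D α β F Wᶜ (.out (.inr τ))
        ≤ ∑ u ∈ Wᶜ, if u = .inp (.inr τ) then α else 0 := by
          refine Finset.sum_le_sum fun u _ => ?_
          rcases u with _ | x | x | S' <;> simp [ifgCapacity]
      _ = _ := by rw [Finset.sum_ite_eq']
  have hN : ∀ τ, ∑ v ∈ N τ, inflow D α β F Wᶜ v ≤ min (c τ) α := by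
    intro τ
    by_cases h : c τ ≤ α
    · have hmem : IFGVertex.inp (.inr τ) ∉ Wᶜ := by
        rw [Finset.mem_compl, not_not]
        refine Finset.mem_union_right _ (Finset.mem_biUnion.2 ⟨τ, Finset.mem_univ _, ?_⟩)
        simp [N, h]
      have h0 := hout τ
      rw [if_neg hmem] at h0
      simp only [N, if_pos h, min_eq_left h]
      rw [Finset.sum_pair (by simp)]
      simpa using add_le_add (hinp τ) h0
    · simp only [N, if_neg h, min_eq_right (not_le.1 h).le, Finset.sum_singleton]
      refine (hout τ).trans ?_
      split_ifs
      · exact le_rfl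
      · exact zero_le
  refine ⟨F, S, (minCut_le_sum _ Wᶜ hsrc hsink).trans ?_⟩
  rw [compl_compl]
  calc ∑ v ∈ W, inflow D α β F Wᶜ v
      ≤ ∑ v ∈ {IFGVertex.dc S}, inflow D α β F Wᶜ v +
          ∑ v ∈ Finset.univ.biUnion N, inflow D α β F Wᶜ v := by
        rw [← Finset.sum_union_inter]
        exact le_self_add
    _ = ∑ v ∈ Finset.univ.biUnion N, inflow D α β F Wᶜ v := by
        rw [Finset.sum_singleton, hdc, zero_add]
    _ = ∑ τ, ∑ v ∈ N τ, inflow D α β F Wᶜ v := by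
        refine Finset.sum_biUnion fun σ _ τ _ hne => Finset.disjoint_left.2 fun v hσ hτ => hne ?_
        simp only [N] at hσ hτ
        split_ifs at hσ hτ <;> simp at hσ hτ <;> grind
    _ ≤ ∑ τ, orderTerm d D α β ρ (Fin.castLE hkn τ) := Finset.sum_le_sum fun τ _ => hN τ
    _ = ∑ p ∈ Finset.univ.map (Fin.castLEEmb hkn), orderTerm d D α β ρ p := by
        rw [Finset.sum_map]; rfl
    _ ≤ _ := by
        refine Finset.sum_le_sum_of_subset fun p hp => ?_
        obtain ⟨τ, -, rfl⟩ := Finset.mem_map.1 hp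
        simp

/-! ### The family helper selection scheme -/

section Family

variable {n d : ℕ}

lemma numFamilies_pos (hd : 1 ≤ d) (hdn : d ≤ n - 1) : 1 ≤ numFamilies n d :=
  (Nat.one_le_div_iff (by omega)).2 (Nat.sub_le _ _)

lemma numFamilies_mul_add (n d : ℕ) : numFamilies n d * (n - d) + n % (n - d) = n := by
  rw [numFamilies, mul_comm, Nat.div_add_mod]

/-- Removing one complete family from the `n` positions leaves `d`. Hence the positive entries of
the family index vector occupy exactly the first `d` positions, the helper set of the incomplete
family. -/
lemma numFamilies_sub_one_mul_add (hd : 1 ≤ d) (hdn : d ≤ n - 1) :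
    (numFamilies n d - 1) * (n - d) + n % (n - d) = d := by
  have h1 := numFamilies_mul_add n d
  obtain ⟨c, hc⟩ := Nat.exists_eq_add_of_le' (numFamilies_pos hd hdn)
  rw [hc] at h1 ⊢
  rw [Nat.add_sub_cancel]
  rw [add_mul] at h1
  omega

/-- The positions carrying `-c` lie in the last complete family, so absolute values name complete
families. -/
lemma div_eq_numFamilies_sub_one (hd : 1 ≤ d) (hdn : d ≤ n - 1) {a : ℕ} (h : d ≤ a)
    (ha : a < numFamilies n d * (n - d)) : a / (n - d) + 1 = numFamilies n d := by
  have h1 := numFamilies_sub_one_mul_add hd hdn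
  have h2 : numFamilies n d - 1 ≤ a / (n - d) := (Nat.le_div_iff_mul_le (by omega)).2 (by omega)
  have h3 : a / (n - d) < numFamilies n d := (Nat.div_lt_iff_lt_mul (by omega)).2 ha
  omega

lemma familyIndexVector_pos_iff (hd : 1 ≤ d) (hdn : d ≤ n - 1) (m : Fin n) :
    0 < familyIndexVector n d m ↔ m.val < d := by
  rw [familyIndexVector, numFamilies_sub_one_mul_add hd hdn]
  split_ifs with h1 h2
  · simp only [h1, iff_true]
    positivity
  · simp [h1]
  · simp [h1]

lemma abs_familyIndexVector (hd : 1 ≤ d) (hdn : d ≤ n - 1) (m : Fin n) :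
    |familyIndexVector n d m| =
      if m.val < numFamilies n d * (n - d) then ((m.val / (n - d) + 1 : ℕ) : ℤ) else 0 := by
  have hlt : d ≤ numFamilies n d * (n - d) := by
    have h1 := numFamilies_mul_add n d
    have h2 := Nat.mod_lt n (show 0 < n - d by omega)
    omega
  rw [familyIndexVector, numFamilies_sub_one_mul_add hd hdn]
  split_ifs with h1 h2 h2
  · exact Nat.abs_cast _
  · omega
  · rw [abs_neg, Nat.abs_cast, div_eq_numFamilies_sub_one hd hdn (not_lt.1 h1) h2]
  · exact abs_zero

lemma lt_numFamilies_mul_iff (hd : 1 ≤ d) (hdn : d ≤ n - 1) (a : ℕ) :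
    a < numFamilies n d * (n - d) ↔ a / (n - d) < numFamilies n d :=
  (Nat.div_lt_iff_lt_mul (by omega)).symm

lemma card_family (hd : 1 ≤ d) (hdn : d ≤ n - 1) {f : ℕ} (hf : f < numFamilies n d) :
    (Finset.univ.filter fun m : Fin n => m.val / (n - d) = f).card = n - d := by
  have h1 : (Finset.univ.filter fun m : Fin n => m.val / (n - d) = f).map Fin.valEmbedding =
      Finset.Ico (f * (n - d)) ((f + 1) * (n - d)) := by
    ext a
    have hle : (f + 1) * (n - d) ≤ n :=
      (Nat.mul_le_mul_right _ hf).trans (Nat.div_mul_le_self _ _)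
    simp only [Finset.mem_map, Finset.mem_filter, Finset.mem_univ, true_and, Fin.valEmbedding_apply,
      Finset.mem_Ico]
    rw [← Nat.le_div_iff_mul_le (by omega), ← Nat.div_lt_iff_lt_mul (by omega)]
    constructor
    · rintro ⟨m, hm, rfl⟩
      omega
    · rintro ⟨h1, h2⟩
      exact ⟨⟨a, ((Nat.div_lt_iff_lt_mul (by omega)).1 h2).trans_le hle⟩, by dsimp only; omega, rfl⟩
  rw [← Finset.card_map Fin.valEmbedding, h1, Nat.card_Ico, add_mul]
  omega

lemma card_fhsHelpers (hd : 1 ≤ d) (hdn : d ≤ n - 1) (e : Equiv.Perm (Fin n)) (i : Fin n) :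
    (fhsHelpers n d e i).card = d := by
  rw [fhsHelpers]
  split_ifs with h
  · rw [lt_numFamilies_mul_iff hd hdn] at h
    have h1 := card_family hd hdn h
    have h2 := Finset.card_filter_add_card_filter_not (s := (Finset.univ : Finset (Fin n)))
      (fun m : Fin n => m.val / (n - d) = (e i).val / (n - d))
    rw [Finset.card_univ, Fintype.card_fin, h1] at h2
    have h3 : (Finset.univ.filter fun u => (e u).val / (n - d) ≠ (e i).val / (n - d)).card =
        (Finset.univ.filter fun m : Fin n => ¬ m.val / (n - d) = (e i).val / (n - d)).card :=
      Finset.card_equiv e (by simp)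
    omega
  · rw [Finset.card_equiv e (t := Finset.univ.filter fun m : Fin n => m.val < d) (by simp),
      Fin.card_filter_val_lt]
    omega

/-- The sign selects the helpers of the incomplete family, and the absolute value separates the
families; this is the test made by `yValue`. -/
lemma mem_fhsHelpers_iff (hd : 1 ≤ d) (hdn : d ≤ n - 1) (e : Equiv.Perm (Fin n)) (u i : Fin n) :
    u ∈ fhsHelpers n d e i ↔
      if familyIndexVector n d (e i) = 0 then 0 < familyIndexVector n d (e u)
      else |familyIndexVector n d (e u)| ≠ |familyIndexVector n d (e i)| := by
  have hzero : familyIndexVector n d (e i) = 0 ↔ ¬ (e i).val < numFamilies n d * (n - d) := by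
    rw [← abs_eq_zero, abs_familyIndexVector hd hdn]
    split_ifs with h
    · simp only [h, not_true_eq_false, iff_false]
      positivity
    · simp [h]
  rw [fhsHelpers]
  by_cases h : (e i).val < numFamilies n d * (n - d)
  · rw [if_pos h, if_neg (hzero.not_left.2 h), abs_familyIndexVector hd hdn,
      abs_familyIndexVector hd hdn, if_pos h, Finset.mem_filter]
    simp only [Finset.mem_univ, true_and]
    split_ifs with hu
    · rw [Ne, Ne, Nat.cast_inj, Nat.add_right_cancel_iff]
    · rw [lt_numFamilies_mul_iff hd hdn] at h hu
      -- Here `u` is in the incomplete family: its entry is `0` and its block number is at least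
      -- `c`, so both inequalities hold.
      exact iff_of_true (fun h' => hu (h' ▸ h)) (by positivity)
  · rw [if_neg h, if_pos (hzero.2 h), familyIndexVector_pos_iff hd hdn]
    simp

lemma yValue_comp (hd : 1 ≤ d) (hdn : d ≤ n - 1) (e ρ : Equiv.Perm (Fin n)) (p : Fin n) :
    yValue (familyIndexVector n d ∘ ρ.trans e) p = earlierHelpers (fhsHelpers n d e) ρ p := by
  rw [yValue, earlierHelpers]
  simp only [mem_fhsHelpers_iff hd hdn, Function.comp_apply, Equiv.trans_apply]
  by_cases h : familyIndexVector n d (e (ρ p)) = 0 <;> simp only [h, if_true, if_false] <;> congr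

lemma familySum_comp (hd : 1 ≤ d) (hdn : d ≤ n - 1) (k : ℕ) (α β : ℝ≥0∞)
    (e ρ : Equiv.Perm (Fin n)) :
    familySum k d α β (familyIndexVector n d ∘ ρ.trans e) =
      ∑ p ∈ Finset.univ.filter (fun p : Fin n => p.val < k),
        orderTerm d (fhsHelpers n d e) α β ρ p := by
  simp only [familySum, orderTerm, yValue_comp hd hdn]

end Family

theorem mainTheorem4 (n k d : ℕ) (hk : 1 ≤ k) (hkn : k ≤ n - 1) (hd : 1 ≤ d) (hdn : d ≤ n - 1)
    (α β : ℝ≥0∞) (e : Equiv.Perm (Fin n)) :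
    ∃ m : ℝ≥0∞,
      IsLeast (minCutValues k (fhsHelpers n d e) α β) m ∧
      IsLeast {v : ℝ≥0∞ | ∃ π : Fin n → ℤ,
        IsFamilyIndexPermutation n d π ∧ v = familySum k d α β π} m := by
  have hD := card_fhsHelpers hd hdn e
  obtain ⟨ρ, -, hρ⟩ := Finset.exists_min_image Finset.univ
    (fun ρ : Equiv.Perm (Fin n) => familySum k d α β (familyIndexVector n d ∘ ρ.trans e))
    Finset.univ_nonempty
  have hlow : familySum k d α β (familyIndexVector n d ∘ ρ.trans e) ∈
      lowerBounds (minCutValues k (fhsHelpers n d e) α β) := by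
    rintro _ ⟨T, F, S, rfl⟩
    refine le_minCut _ fun U hs ht => ?_
    obtain ⟨ρ', h⟩ := exists_sum_orderTerm_le (α := α) (β := β) (F := F) hD hs ht
    exact ((hρ ρ' (Finset.mem_univ _)).trans_eq (familySum_comp hd hdn k α β e ρ')).trans h
  refine ⟨_, ⟨?_, hlow⟩, ⟨_, ⟨ρ.trans e, rfl⟩, rfl⟩, ?_⟩
  · obtain ⟨F, S, h⟩ := exists_minCut_le_sum_orderTerm (by omega : k ≤ n) hD α β ρ
    rw [← familySum_comp hd hdn] at h
    exact ⟨k, F, S, le_antisymm (hlow ⟨k, F, S, rfl⟩) h⟩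
  · rintro _ ⟨_, ⟨σ, rfl⟩, rfl⟩
    -- Any rearrangement `σ` comes from the order `σ.trans e.symm`.
    have h := hρ (σ.trans e.symm) (Finset.mem_univ _)
    rwa [Equiv.trans_assoc, Equiv.symm_trans_self, Equiv.trans_refl] at h
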